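/- Let $\beta>1$ be a Pisot unit, that is, an algebraic integer whose minimal polynomial $g(x)=x^m-k_1x^{m-1}-\dots-k_m\in\mathbb Z[x]$ has $k_m=\pm1$ and whose conjugates other than $\beta$ have modulus $<1$. Assume that $\beta$ is finitary: an $x\in[0,1)$ has a finite $\beta$-expansion (greedy expansion $x=\sum_{k\ge1}\varepsilon_k\beta^{-k}$, $\varepsilon_1=\lfloor\beta x\rfloor$, $\varepsilon_2=\lfloor\beta\{\beta x\}\rfloor$, etc.) if and only if $x\in\mathbb Z[\beta]$. Let $(d'_n)_{n\ge1}$ be the greedy expansion of $1$; put $d=d'$ if $d'$ has infinitely many nonzero terms, and otherwise let $d$ be the periodic sequence with period $(d'_1,\dots,d'_{k-1},d'_k-1)$, where $d'_k$ is the last nonzero term. Let $X_\beta$ be the set of sequences $(\varepsilon_n)_{n\in\mathbb Z}$ of non-negative integers such that $(\varepsilon_n,\varepsilon_{n+1},\dots)$ is strictly smaller than $d$ in the lexicographic order for every $n\in\mathbb Z$. Let $T$ be the automorphism of the torus $\mathbb T^m=\mathbb R^m/\mathbb Z^m$ given by the companion matrix $M$ with first row $(k_1,\dots,k_m)$, ones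 just below the diagonal and zeros elsewhere. Put $\xi_0=1/g'(\beta)$, and, modulo $\mathbb Z^m$, $t=(1,\beta^{-1},\dots,\beta^{-m+1})$ and $t_0=(\xi_0,\xi_0\beta^{-1},\dots,\xi_0\beta^{-m+1})$. For $\varepsilon\in X_\beta$ let $$\varphi_0(\varepsilon)=\sum_{k\in\mathbb Z}\varepsilon_kT^{-k}t_0,\qquad \varphi(\varepsilon)=\sum_{k\in\mathbb Z}\varepsilon_kT^{-k}t .$$ Let $\beta_1=\beta,\beta_2,\dots,\beta_m$ be the conjugates of $\beta$ and $D(\beta)=\prod_{i<j}(\beta_i-\beta_j)^2$ its discriminant. Then both series converge for every $\varepsilon\in X_\beta$, and $\varphi\circ\varphi_0^{-1}$ is well defined almost everywhere on $\mathbb T^m$: for Haar-almost every $x$ there is exactly one $y$ such that $\varphi_0(\varepsilon)=x$ and $\varphi(\varepsilon)=y$ for some $\varepsilon\in X_\beta$. There is exactly one continuous map $A:\mathbb T^m\to\mathbb T^m$ that agrees with $\varphi\circ\varphi_0^{-1}$ almost everywhere. It is an endomorphism of the torus, given by a unique integer matrix $N$. For every $p\in\mathbb Z[x]$ with $p(\beta)=\xi_0^{-1}=g'(\beta)$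 one has $A=p(T)$ and $N=p(M)$. The determinant of $A$, that is $\det N$, equals $D(\beta)$ or $-D(\beta)$. -/

import Mathlib

open Polynomial MeasureTheory

noncomputable section

namespace PisotCoding

/-- The characteristic polynomial `g` of the algebraic integer `β`. -/
abbrev charPol (β : ℝ) : ℤ[X] := minpoly ℤ β

/-- The degree `m` of `β`. -/
abbrev deg (β : ℝ) : ℕ := (charPol β).natDegree

/-- `β > 1` is an algebraic integer all of whose other conjugates have modulus less than one. -/
structure IsPisot (β : ℝ) : Prop where
  one_lt : 1 < β
  isIntegral : IsIntegral ℤ β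
  norm_conj_lt : ∀ z : ℂ, aeval z (charPol β) = 0 → z ≠ (β : ℂ) → ‖z‖ < 1

/-- A Pisot number whose minimal polynomial has constant term `±1`. -/
structure IsPisotUnit (β : ℝ) : Prop extends IsPisot β where
  coeff_zero : (charPol β).coeff 0 = 1 ∨ (charPol β).coeff 0 = -1

/-- The digits given by the greedy algorithm in base `β`, indexed from `0`:
`⌊βx⌋, ⌊β{βx}⌋, …`. -/
def greedyDigit (β x : ℝ) (n : ℕ) : ℕ := ⌊β * (fun y : ℝ => Int.fract (β * y))^[n] x⌋₊

/-- The sequence has the tail `0^∞`. -/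
def EndsInZeros (s : ℕ → ℕ) : Prop := ∃ N, ∀ n, N ≤ n → s n = 0

/-- Those `x ∈ [0,1)` whose `β`-expansion is finite. -/
def finiteExpansions (β : ℝ) : Set ℝ := {x | x ∈ Set.Ico (0 : ℝ) 1 ∧ EndsInZeros (greedyDigit β x)}

/-- `Fin(β) = ℤ[β] ∩ [0,1)`. -/
def IsFinitary (β : ℝ) : Prop :=
  finiteExpansions β = (Algebra.adjoin ℤ {β} : Set ℝ) ∩ Set.Ico (0 : ℝ) 1

open Classical in
/-- The sequence `d`, indexed from `0`. It is the greedy expansion `d'` of `1` if that is not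
finite; otherwise, with `d'_0, …, d'_{k-1}` the part of `d'` up to its last nonzero digit, it is
the periodic sequence with period `d'_0, …, d'_{k-2}, d'_{k-1} - 1`. -/
def quasiGreedyOne (β : ℝ) : ℕ → ℕ :=
  if h : EndsInZeros (greedyDigit β 1) then
    fun n =>
      if n % Nat.find h + 1 = Nat.find h then greedyDigit β 1 (n % Nat.find h) - 1
      else greedyDigit β 1 (n % Nat.find h)
  else greedyDigit β 1

/-- Strict lexicographic order on one-sided sequences. -/
def LexLT (x y : ℕ → ℕ) : Prop := ∃ n, (∀ i < n, x i = y i) ∧ x n < y n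

/-- The two-sided `β`-compactum `X_β`. -/
def compactum (β : ℝ) : Set (ℤ → ℕ) :=
  {ε | ∀ n : ℤ, LexLT (fun j : ℕ => ε (n + j)) (quasiGreedyOne β)}

/-- The torus `ℝ^m / ℤ^m`. -/
abbrev Torus (m : ℕ) : Type := UnitAddTorus (Fin m)

/-- The endomorphism of the torus given by an integer matrix. -/
def toralEnd {m : ℕ} (N : Matrix (Fin m) (Fin m) ℤ) : AddMonoid.End (Torus m) :=
  AddMonoidHom.mk' (fun x i => ∑ j, N i j • x j) (by
    intro x y
    funext i
    simp [smul_add, Finset.sum_add_distrib])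

/-- The companion matrix `M(β)`: with `g = x^m - k_1 x^(m-1) - … - k_m`, its first row is
`k_1, …, k_m` and it has ones just below the diagonal. -/
def companion (β : ℝ) : Matrix (Fin (deg β)) (Fin (deg β)) ℤ :=
  Matrix.of fun i j =>
    if (i : ℕ) = 0 then -(charPol β).coeff (deg β - 1 - j)
    else if (i : ℕ) = j + 1 then 1 else 0

/-- The toral automorphism `T = T(β)`. -/
def T (β : ℝ) : AddMonoid.End (Torus (deg β)) := toralEnd (companion β)

/-- `T^k` for `k : ℤ`; `companion β` has determinant `±1` when `β` is a unit. -/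
def Tpow (β : ℝ) (k : ℤ) : AddMonoid.End (Torus (deg β)) := toralEnd (companion β ^ k)

/-- `ξ₀ = 1 / g'(β)`. -/
def xi₀ (β : ℝ) : ℝ := (aeval β (derivative (charPol β)))⁻¹

/-- The point `(ξ, ξβ⁻¹, …, ξβ^{-m+1})` of the torus. -/
def homoclinic (β ξ : ℝ) : Torus (deg β) :=
  fun i => ((ξ * β⁻¹ ^ (i : ℕ) : ℝ) : UnitAddCircle)

/-- The terms `ε_k T^{-k} t` of the coding series, for `t = (ξ, ξβ⁻¹, …)`. -/
def codingTerm (β ξ : ℝ) (ε : ℤ → ℕ) (k : ℤ) : Torus (deg β) :=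
  ε k • Tpow β (-k) (homoclinic β ξ)

/-- `ε ↦ ∑_{k ∈ ℤ} ε_k T^{-k} t`, for `t = (ξ, ξβ⁻¹, …)`. -/
def coding (β ξ : ℝ) (ε : ℤ → ℕ) : Torus (deg β) := ∑' k : ℤ, codingTerm β ξ ε k

/-- The coding `φ₀`. -/
def phi₀ (β : ℝ) : (ℤ → ℕ) → Torus (deg β) := coding β (xi₀ β)

/-- The coding `φ`. -/
def phi (β : ℝ) : (ℤ → ℕ) → Torus (deg β) := coding β 1

/-- `y` is a value of `φ ∘ φ₀⁻¹` at `x`. -/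
def IsValue (β : ℝ) (x y : Torus (deg β)) : Prop :=
  ∃ ε ∈ compactum β, phi₀ β ε = x ∧ phi β ε = y

/-- `A` is continuous and agrees with `φ ∘ φ₀⁻¹` almost everywhere for Haar measure. -/
def IsContinuousExtension (β : ℝ) (A : Torus (deg β) → Torus (deg β)) : Prop :=
  Continuous A ∧ ∀ᵐ x ∂(volume : Measure (Torus (deg β))), IsValue β x (A x)

/-- The discriminant `∏_{i<j} (β_i - β_j)²` of the numbers `β_1, …, β_m`. -/
def discriminant {m : ℕ} (b : Fin m → ℂ) : ℂ := ∏ i, ∏ j ∈ Finset.Ioi i, (b i - b j) ^ 2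

end PisotCoding

end

/-! The vector $(1,\beta^{-1},\dots,\beta^{-m+1})$ is an eigenvector of $M$ for $\beta$, so $p(T)$
multiplies the parameter $\xi$ of a point $(\xi,\xi\beta^{-1},\dots)$ by $p(\beta)$. Hence
$t=g'(T)t_0$, and termwise $\varphi=g'(T)\circ\varphi_0$ on all of $X_\beta$
(`phi_eq_toralEnd_phi₀`). The value of $\varphi\circ\varphi_0^{-1}$ at a point of
$\varphi_0(X_\beta)$ is therefore forced, and what has to be proved is that $\varphi_0(X_\beta)$ has
full measure (`ae_mem_phi₀_image`).

Convergence to the left rests on Euler's formula: $u_j=\sum_i\beta_i^j/g'(\beta_i)$ is an integer,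
and $\xi_0\beta^j-u_j$ involves only the contracted conjugates, so it decays geometrically
(`exists_trace_sequence`). With digits uniformly bounded, $\varphi_0$ is continuous. The image of
$X_\beta$ contains the ray $\{st_0:s\ge0\}$, by greedy expansion of $s$; the ray is dense by
Kronecker (`dense_proj_ray`), so the compact closure of $X_\beta$ maps onto the torus. A sequence in
the closure but outside $X_\beta$ ends in $d$. Once its tail is fixed, its image lies in the
projection of an affine hyperplane parallel to the contracted directions, a null set
(`volume_phi₀_image_tail`), and there are only countably many positions for the tail.

The determinant comes from diagonalizing $M$ by a Vandermonde matrix: $\det p(M)=\prod_i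
p(\beta_i)$, and $\prod_i g'(\beta_i)=\pm D(\beta)$. -/

noncomputable section

namespace PisotCoding

/-! ### Conjugates of β, the discriminant and trace integers. -/

section Conjugates

variable {β : ℝ} {b : Fin (deg β) → ℂ}

theorem aeval_eq_eval_map (z : ℂ) (p : ℤ[X]) :
    aeval z p = (p.map (Int.castRingHom ℂ)).eval z := by
  rw [aeval_def, eval_map]; rfl

theorem aeval_ofReal (x : ℝ) (p : ℤ[X]) : aeval (x : ℂ) p = ((aeval x p : ℝ) : ℂ) := by
  have := Polynomial.aeval_algebraMap_apply ℂ x p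
  simpa using this

/-- Since ℤ is integrally closed, the minimal polynomial over ℤ is also the one over ℚ, which is
irreducible in characteristic zero and hence separable. -/
theorem conj_injective (hβ : IsIntegral ℤ β)
    (hb : (charPol β).map (Int.castRingHom ℂ) = ∏ i, (X - C (b i))) : Function.Injective b := by
  rw [← separable_prod_X_sub_C_iff, ← hb]
  have h1 : (minpoly ℚ β).Separable := (minpoly.irreducible hβ.tower_top).separable
  rw [minpoly.isIntegrallyClosed_eq_field_fractions' ℚ hβ] at h1
  have h2 := h1.map (f := algebraMap ℚ ℂ)
  rwa [Polynomial.map_map, RingHom.ext_int ((algebraMap ℚ ℂ).comp (algebraMap ℤ ℚ))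
    (Int.castRingHom ℂ)] at h2

theorem aeval_charPol_eq_zero_iff
    (hb : (charPol β).map (Int.castRingHom ℂ) = ∏ i, (X - C (b i))) (z : ℂ) :
    aeval z (charPol β) = 0 ↔ ∃ i, z = b i := by
  rw [aeval_eq_eval_map, hb, eval_prod, Finset.prod_eq_zero_iff]
  simp [sub_eq_zero]

theorem aeval_conj_eq_zero (hβ : IsIntegral ℤ β)
    (hb : (charPol β).map (Int.castRingHom ℂ) = ∏ i, (X - C (b i))) {p : ℤ[X]}
    (hp : aeval β p = 0) (i : Fin (deg β)) : aeval (b i) p = 0 := by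
  obtain ⟨q, rfl⟩ := minpoly.isIntegrallyClosed_dvd hβ hp
  rw [map_mul, (aeval_charPol_eq_zero_iff hb _).2 ⟨i, rfl⟩, zero_mul]

theorem aeval_conj_congr (hβ : IsIntegral ℤ β)
    (hb : (charPol β).map (Int.castRingHom ℂ) = ∏ i, (X - C (b i))) {p q : ℤ[X]}
    (hp : aeval β p = aeval β q) (i : Fin (deg β)) : aeval (b i) p = aeval (b i) q := by
  rw [← sub_eq_zero, ← map_sub]
  exact aeval_conj_eq_zero hβ hb (by rw [map_sub, hp, sub_self]) i

theorem exists_conj_eq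
    (hb : (charPol β).map (Int.castRingHom ℂ) = ∏ i, (X - C (b i))) : ∃ i, b i = (β : ℂ) := by
  obtain ⟨i, hi⟩ := (aeval_charPol_eq_zero_iff hb (β : ℂ)).1 (by
    rw [aeval_ofReal, minpoly.aeval, Complex.ofReal_zero])
  exact ⟨i, hi.symm⟩

theorem aeval_conj_derivative
    (hb : (charPol β).map (Int.castRingHom ℂ) = ∏ i, (X - C (b i))) (i : Fin (deg β)) :
    aeval (b i) (derivative (charPol β)) = ∏ j ∈ Finset.univ.erase i, (b i - b j) := by
  rw [aeval_eq_eval_map, ← derivative_map, hb]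
  have := Lagrange.eval_nodal_derivative_eval_node_eq (v := b) (Finset.mem_univ i)
  rw [Lagrange.nodal] at this
  rw [this, Lagrange.eval_nodal]

theorem aeval_conj_derivative_ne_zero (hβ : IsIntegral ℤ β)
    (hb : (charPol β).map (Int.castRingHom ℂ) = ∏ i, (X - C (b i))) (i : Fin (deg β)) :
    aeval (b i) (derivative (charPol β)) ≠ 0 := by
  rw [aeval_conj_derivative hb, Finset.prod_ne_zero_iff]
  intro j hj h
  exact (Finset.ne_of_mem_erase hj) (conj_injective hβ hb (sub_eq_zero.1 h)).symm

theorem aeval_derivative_ne_zero (hβ : IsIntegral ℤ β)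
    (hb : (charPol β).map (Int.castRingHom ℂ) = ∏ i, (X - C (b i))) :
    aeval β (derivative (charPol β)) ≠ 0 := by
  obtain ⟨i, hi⟩ := exists_conj_eq hb
  have := aeval_conj_derivative_ne_zero hβ hb i
  rw [hi, aeval_ofReal] at this
  exact_mod_cast this

/-- The pairs $(i,j)$ and $(j,i)$ together contribute $-(b_i-b_j)^2$; only the overall sign is left
undetermined. -/
theorem prod_conj_derivative
    (hb : (charPol β).map (Int.castRingHom ℂ) = ∏ i, (X - C (b i))) :
    ∏ i, aeval (b i) (derivative (charPol β)) = discriminant b ∨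
      ∏ i, aeval (b i) (derivative (charPol β)) = -discriminant b := by
  have h := Finset.prod_prod_Ioi_mul_eq_prod_prod_off_diag (fun i j => b j - b i)
  have h1 : ∏ i, aeval (b i) (derivative (charPol β)) =
      ∏ i, ∏ j ∈ Finset.Ioi i, (-1 : ℂ) * (b i - b j) ^ 2 := by
    calc _ = ∏ i, ∏ j ∈ ({i} : Finset _)ᶜ, (b i - b j) := by
          refine Finset.prod_congr rfl fun i _ => ?_
          rw [aeval_conj_derivative hb]
          refine Finset.prod_congr ?_ fun _ _ => rfl
          ext; simp
      _ = _ := by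
          rw [← h]
          refine Finset.prod_congr rfl fun i _ => Finset.prod_congr rfl fun j _ => ?_
          ring
  simp only [Finset.prod_mul_distrib, Finset.prod_const, Finset.prod_pow_eq_pow_sum] at h1
  rw [h1, discriminant]
  rcases neg_one_pow_eq_or ℂ (∑ i : Fin (deg β), (Finset.Ioi i).card) with h | h <;>
    rw [h] <;> simp

/-- Euler's trace formula: `∑ P(βᵢ) / g'(βᵢ)` is an integer for integral `P`. -/
theorem exists_int_eq_sum_div_derivative (hβ : IsIntegral ℤ β)
    (hb : (charPol β).map (Int.castRingHom ℂ) = ∏ i, (X - C (b i))) (P : ℤ[X]) :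
    ∃ u : ℤ, ∑ i, aeval (b i) P / aeval (b i) (derivative (charPol β)) = u := by
  have hm : (charPol β).Monic := minpoly.monic hβ
  -- By Lagrange interpolation at the roots, the sum is the coefficient of $x^{m-1}$ in the
  -- remainder of $P$ modulo the monic $g$, hence an integer.
  refine ⟨(P %ₘ charPol β).coeff (deg β - 1), ?_⟩
  have h := Lagrange.coeff_eq_sum (s := Finset.univ) (v := b) (conj_injective hβ hb).injOn
    (P := (P %ₘ charPol β).map (Int.castRingHom ℂ)) (by
      refine degree_map_le.trans_lt ?_
      rw [Finset.card_univ, Fintype.card_fin, ← degree_eq_natDegree hm.ne_zero]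
      exact degree_modByMonic_lt _ hm)
  rw [Finset.card_univ, Fintype.card_fin, coeff_map, eq_intCast] at h
  rw [h]
  refine Finset.sum_congr rfl fun i _ => ?_
  rw [aeval_conj_derivative hb, ← aeval_eq_eval_map]
  congr 1
  conv_lhs => rw [← modByMonic_add_div P (charPol β)]
  rw [map_add, map_mul, (aeval_charPol_eq_zero_iff hb _).2 ⟨i, rfl⟩, zero_mul, add_zero]

theorem exists_aeval_eq_inv (hβ : IsPisotUnit β) : ∃ q : ℤ[X], aeval β q = β⁻¹ := by
  have h0 : β ≠ 0 := (zero_lt_one.trans hβ.one_lt).ne'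
  have h : aeval β (charPol β) = 0 := minpoly.aeval _ _
  rw [← divX_mul_X_add (charPol β)] at h
  simp only [map_add, map_mul, aeval_X, eq_intCast] at h
  rcases hβ.coeff_zero with h1 | h1
  · refine ⟨-divX (charPol β), ?_⟩
    rw [h1] at h
    rw [map_neg, ← mul_eq_one_iff_eq_inv₀ h0]
    simp at h; linarith
  · refine ⟨divX (charPol β), ?_⟩
    rw [h1] at h
    rw [← mul_eq_one_iff_eq_inv₀ h0]
    simp at h; linarith

theorem conj_ne_zero (hβ : IsPisotUnit β)
    (hb : (charPol β).map (Int.castRingHom ℂ) = ∏ i, (X - C (b i))) (i : Fin (deg β)) :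
    b i ≠ 0 := by
  intro h
  have h1 := (aeval_charPol_eq_zero_iff hb (b i)).2 ⟨i, rfl⟩
  rw [h, aeval_eq_eval_map, ← coeff_zero_eq_eval_zero, coeff_map] at h1
  rcases hβ.coeff_zero with h2 | h2 <;> simp [h2] at h1

/-- Integral powers of the conjugates are values of one integral polynomial. -/
theorem exists_aeval_eq_zpow (hβ : IsPisotUnit β)
    (hb : (charPol β).map (Int.castRingHom ℂ) = ∏ i, (X - C (b i))) (j : ℤ) :
    ∃ P : ℤ[X], ∀ i, aeval (b i) P = b i ^ j := by
  obtain ⟨q, hq⟩ := exists_aeval_eq_inv hβ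
  have hconj : ∀ i, aeval (b i) q = (b i)⁻¹ := fun i => by
    have h0 : β ≠ 0 := (zero_lt_one.trans hβ.one_lt).ne'
    have := aeval_conj_congr hβ.isIntegral hb (p := q * X) (q := 1) (by simp [hq, h0]) i
    rw [← mul_eq_one_iff_eq_inv₀ (conj_ne_zero hβ hb i)]
    simpa using this
  rcases Int.eq_nat_or_neg j with ⟨n, rfl | rfl⟩
  · exact ⟨X ^ n, fun i => by simp⟩
  · exact ⟨q ^ n, fun i => by simp [hconj]⟩

/-- The hyperplane spanned by the contracted eigenvectors, together with integers approximating
`ξ₀ β^j`. -/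
theorem exists_trace_sequence (hβ : IsPisotUnit β)
    (hb : (charPol β).map (Int.castRingHom ℂ) = ∏ i, (X - C (b i))) :
    ∃ (u : ℤ → ℤ) (K ρ : ℝ) (l : Fin (deg β) → ℝ), 0 < ρ ∧ ρ < 1 ∧ l ≠ 0 ∧
      (∀ n : ℕ, |xi₀ β * β ^ (n : ℤ) - u n| ≤ K * ρ ^ n) ∧
      ∀ j : ℤ, ∑ i, l i * (xi₀ β * β ^ (j - (i : ℕ)) - u (j - (i : ℕ))) = 0 := by
  have hm : (charPol β).Monic := minpoly.monic hβ.isIntegral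
  obtain ⟨i₀, hi₀⟩ := exists_conj_eq hb
  have hu : ∀ j : ℤ, ∃ u : ℤ,
      ∑ i, b i ^ j / aeval (b i) (derivative (charPol β)) = u := fun j => by
    obtain ⟨P, hP⟩ := exists_aeval_eq_zpow hβ hb j
    obtain ⟨u, h⟩ := exists_int_eq_sum_div_derivative hβ.isIntegral hb P
    exact ⟨u, by rw [← h]; simp only [hP]⟩
  choose u hu using hu
  have hy : ∀ j : ℤ, ((xi₀ β * β ^ j - u j : ℝ) : ℂ) =
      -∑ i ∈ Finset.univ.erase i₀, b i ^ j / aeval (b i) (derivative (charPol β)) := fun j => by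
    have := hu j
    rw [← Finset.add_sum_erase _ _ (Finset.mem_univ i₀), hi₀, aeval_ofReal] at this
    push_cast [xi₀]
    rw [← this]
    ring
  have hlt : ∀ i ∈ Finset.univ.erase i₀, ‖b i‖ < 1 := fun i hi => by
    refine hβ.norm_conj_lt _ ((aeval_charPol_eq_zero_iff hb _).2 ⟨i, rfl⟩) ?_
    rw [← hi₀]
    exact fun h => Finset.ne_of_mem_erase hi (conj_injective hβ.isIntegral hb h)
  -- Choosing ρ close to 1 from below, rather than as a maximum, keeps it positive even when β has
  -- no other conjugates.
  obtain ⟨ρ, hρ0, hρ1, hρ⟩ : ∃ ρ : ℝ, 0 < ρ ∧ ρ < 1 ∧ ∀ i ∈ Finset.univ.erase i₀, ‖b i‖ ≤ ρ := by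
    have h : ∀ᶠ ρ : ℝ in nhdsWithin 1 (Set.Iio 1), ∀ i ∈ Finset.univ.erase i₀, ‖b i‖ ≤ ρ := by
      rw [Filter.eventually_all_finset]
      intro i hi
      filter_upwards [mem_nhdsWithin_of_mem_nhds (Ioi_mem_nhds (hlt i hi))] with x hx
      exact le_of_lt hx
    have h0 : ∀ᶠ ρ : ℝ in nhdsWithin 1 (Set.Iio 1), 0 < ρ :=
      mem_nhdsWithin_of_mem_nhds (Ioi_mem_nhds zero_lt_one)
    have h' : ∀ᶠ ρ : ℝ in nhdsWithin 1 (Set.Iio 1), ρ < 1 := self_mem_nhdsWithin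
    obtain ⟨ρ, h1, h2, h3⟩ := (h.and (h0.and h')).exists
    exact ⟨ρ, h2, h3, h1⟩
  -- The functional `l` is read off from $h=g/(x-\beta)$: on $(1,b_i^{-1},\dots,b_i^{-m+1})$ it
  -- takes the value $b_i^{-(m-1)}h(b_i)$, which vanishes for every contracted conjugate.
  obtain ⟨h, hh⟩ : ∃ h : ℝ[X], (charPol β).map (Int.castRingHom ℝ) = (X - C β) * h := by
    refine dvd_iff_isRoot.2 ?_
    rw [IsRoot, eval_map]
    exact minpoly.aeval ℤ β
  have hhm : h.Monic := by
    have := hm.map (Int.castRingHom ℝ)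
    rw [hh] at this
    exact (monic_X_sub_C β).of_mul_monic_left this
  have hhd : h.natDegree + 1 = deg β := by
    have := congrArg natDegree hh
    rw [hm.natDegree_map, (monic_X_sub_C β).natDegree_mul hhm, natDegree_X_sub_C] at this
    rw [deg, this, add_comm]
  have hroot : ∀ i ∈ Finset.univ.erase i₀, aeval (b i) h = 0 := fun i hi => by
    have h1 := (aeval_charPol_eq_zero_iff hb (b i)).2 ⟨i, rfl⟩
    have h2 := congrArg (aeval (b i)) hh
    rw [← algebraMap_int_eq, aeval_map_algebraMap, h1, map_mul] at h2
    refine (mul_eq_zero.1 h2.symm).resolve_left ?_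
    simp only [map_sub, aeval_X, aeval_C, Complex.coe_algebraMap, sub_eq_zero, ← hi₀]
    exact fun h => Finset.ne_of_mem_erase hi (conj_injective hβ.isIntegral hb h)
  refine ⟨u, ∑ i ∈ Finset.univ.erase i₀, ‖(aeval (b i) (derivative (charPol β)))⁻¹‖, ρ,
    fun i => h.coeff (deg β - 1 - i), hρ0, hρ1, ?_, fun n => ?_, fun j => ?_⟩
  · intro h0
    have := congrFun h0 ⟨0, by omega⟩
    simp only [Pi.zero_apply, Nat.sub_zero] at this
    rw [show deg β - 1 = h.natDegree by omega, hhm.coeff_natDegree] at this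
    exact one_ne_zero this
  · rw [← Real.norm_eq_abs, ← Complex.norm_real, hy, norm_neg, Finset.sum_mul]
    refine (norm_sum_le _ _).trans (Finset.sum_le_sum fun i hi => ?_)
    rw [div_eq_mul_inv, norm_mul, mul_comm, zpow_natCast, norm_pow]
    gcongr
    exact hρ i hi
  · rw [← Complex.ofReal_inj, Complex.ofReal_sum]
    simp only [Complex.ofReal_mul, hy, mul_neg, Finset.sum_neg_distrib, Finset.mul_sum]
    rw [Finset.sum_comm, Complex.ofReal_zero, neg_eq_zero]
    refine Finset.sum_eq_zero fun i hi => ?_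
    have h1 := hroot i hi
    rw [aeval_eq_sum_range, hhd, ← Finset.sum_range_reflect, Finset.sum_range] at h1
    calc _ = (∑ k : Fin (deg β), h.coeff (deg β - 1 - k) • b i ^ (deg β - 1 - (k : ℕ))) *
          (b i ^ (j - (deg β - 1 : ℕ)) / aeval (b i) (derivative (charPol β))) := by
          rw [Finset.sum_mul]
          refine Finset.sum_congr rfl fun k _ => ?_
          rw [Complex.real_smul, mul_assoc, ← mul_div_assoc (b i ^ _), ← zpow_natCast,
            ← zpow_add₀ (conj_ne_zero hβ hb i)]
          congr 4
          have := k.2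
          omega
      _ = 0 := by rw [h1, zero_mul]

end Conjugates

/-! ### Diagonalization of the companion matrix. -/

section Companion

variable {β : ℝ} {b : Fin (deg β) → ℂ}

/-- The first row is $g(z)=0$ divided by $z^{m-1}$; each other row is a shift. A general field is
used so as to cover both real β and the complex conjugates. -/
theorem sum_companion_mul {R : Type*} [Field R] (hβ : IsIntegral ℤ β) {z : R} (hz : z ≠ 0)
    (h : aeval z (charPol β) = 0) (i : Fin (deg β)) :
    ∑ j, (companion β i j : R) * z⁻¹ ^ (j : ℕ) = z * z⁻¹ ^ (i : ℕ) := by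
  have hm : (charPol β).Monic := minpoly.monic hβ
  by_cases hi : (i : ℕ) = 0
  · have hpos : 0 < deg β := i.pos
    simp only [companion, Matrix.of_apply, hi, if_true, pow_zero, mul_one]
    rw [aeval_eq_sum_range, Finset.sum_range_succ, hm.coeff_natDegree, one_smul,
      ← Finset.sum_range_reflect, Finset.sum_range] at h
    have h2 : z ^ (deg β - 1) ≠ 0 := pow_ne_zero _ hz
    rw [← mul_left_inj' h2, ← pow_succ', Nat.sub_add_cancel hpos, eq_comm,
      eq_neg_of_add_eq_zero_right h, Finset.sum_mul, ← Finset.sum_neg_distrib]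
    refine Finset.sum_congr rfl fun k _ => ?_
    have hk : deg β - 1 = (deg β - 1 - k) + k := by have := k.2; simp only [deg] at *; omega
    conv_rhs => rw [hk, pow_add]
    have hk' : z ^ (k : ℕ) ≠ 0 := pow_ne_zero _ hz
    rw [← hk, zsmul_eq_mul]
    push_cast
    rw [inv_pow]
    field_simp
  · have hlt : (i : ℕ) - 1 < deg β := by omega
    rw [Finset.sum_eq_single ⟨(i : ℕ) - 1, hlt⟩]
    · have h1 : (i : ℕ) = (i - 1) + 1 := by omega
      simp only [companion, Matrix.of_apply, hi, if_false, if_pos h1, Int.cast_one, one_mul]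
      conv_rhs => rw [h1, pow_succ]
      field_simp
    · intro j _ hj
      have : ¬ (i : ℕ) = j + 1 := fun h => hj (Fin.ext (by simp; omega))
      simp [companion, hi, this]
    · simp

/-- The matrix whose columns are the eigenvectors of the companion matrix. -/
def eigenMatrix {m : ℕ} (b : Fin m → ℂ) : Matrix (Fin m) (Fin m) ℂ :=
  (Matrix.vandermonde fun i => (b i)⁻¹).transpose

theorem isUnit_eigenMatrix (hβ : IsIntegral ℤ β)
    (hb : (charPol β).map (Int.castRingHom ℂ) = ∏ i, (X - C (b i))) : IsUnit (eigenMatrix b) := by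
  rw [Matrix.isUnit_iff_isUnit_det, isUnit_iff_ne_zero, eigenMatrix, Matrix.det_transpose,
    Matrix.det_vandermonde_ne_zero_iff]
  exact inv_injective.comp (conj_injective hβ hb)

theorem companion_mul_eigenMatrix (hβ : IsPisotUnit β)
    (hb : (charPol β).map (Int.castRingHom ℂ) = ∏ i, (X - C (b i))) :
    (companion β).map (Int.castRingHom ℂ) * eigenMatrix b =
      eigenMatrix b * Matrix.diagonal b := by
  ext i j
  rw [Matrix.mul_diagonal, Matrix.mul_apply]
  have := sum_companion_mul hβ.isIntegral (conj_ne_zero hβ hb j)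
    ((aeval_charPol_eq_zero_iff hb _).2 ⟨j, rfl⟩) i
  simpa [eigenMatrix, Matrix.vandermonde_apply, mul_comm] using this

theorem aeval_companion_mul_eigenMatrix (hβ : IsPisotUnit β)
    (hb : (charPol β).map (Int.castRingHom ℂ) = ∏ i, (X - C (b i))) (p : ℤ[X]) :
    (aeval (companion β) p).map (Int.castRingHom ℂ) * eigenMatrix b =
      eigenMatrix b * Matrix.diagonal fun i => aeval (b i) p := by
  have hmap : (aeval (companion β) p).map (Int.castRingHom ℂ) =
      aeval ((companion β).map (Int.castRingHom ℂ)) p := by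
    have := Polynomial.aeval_algHom_apply
      ((Int.castRingHom ℂ).mapMatrix (m := Fin (deg β))).toIntAlgHom (companion β) p
    exact this.symm
  have hdiag : (Matrix.diagonal fun i => aeval (b i) p) = aeval (Matrix.diagonal b) p := by
    rw [show (fun i => aeval (b i) p) = aeval b p from
      funext fun i => (Polynomial.aeval_algHom_apply (Pi.evalAlgHom ℤ (fun _ => ℂ) i) b p)]
    exact (Polynomial.aeval_algHom_apply
      (Matrix.diagonalRingHom (Fin (deg β)) ℂ).toIntAlgHom b p).symm
  have hsemi : SemiconjBy (eigenMatrix b) (Matrix.diagonal b)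
      ((companion β).map (Int.castRingHom ℂ)) := (companion_mul_eigenMatrix hβ hb).symm
  rw [hmap, hdiag, aeval_eq_sum_range, aeval_eq_sum_range, Finset.sum_mul, Finset.mul_sum]
  refine Finset.sum_congr rfl fun n _ => ?_
  rw [smul_mul_assoc, mul_smul_comm, (hsemi.pow_right n).eq]

/-- Polynomials that agree at β agree at all conjugates, so they give matrices with the same
eigenvalues on a common eigenbasis. -/
theorem aeval_companion_congr (hβ : IsPisotUnit β)
    (hb : (charPol β).map (Int.castRingHom ℂ) = ∏ i, (X - C (b i))) {p q : ℤ[X]}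
    (h : aeval β p = aeval β q) : aeval (companion β) p = aeval (companion β) q := by
  have h1 := aeval_companion_mul_eigenMatrix hβ hb p
  rw [funext fun i => aeval_conj_congr hβ.isIntegral hb h i,
    ← aeval_companion_mul_eigenMatrix hβ hb q,
    (isUnit_eigenMatrix hβ.isIntegral hb).mul_left_inj] at h1
  exact Matrix.map_injective (Int.castRingHom ℂ).injective_int h1

theorem det_aeval_companion (hβ : IsPisotUnit β)
    (hb : (charPol β).map (Int.castRingHom ℂ) = ∏ i, (X - C (b i))) (p : ℤ[X]) :
    ((aeval (companion β) p).det : ℂ) = ∏ i, aeval (b i) p := by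
  have h1 := congrArg Matrix.det (aeval_companion_mul_eigenMatrix hβ hb p)
  rw [Matrix.det_mul, Matrix.det_mul, Matrix.det_diagonal, mul_comm, mul_right_inj'
    ((Matrix.isUnit_iff_isUnit_det _).1 (isUnit_eigenMatrix hβ.isIntegral hb)).ne_zero] at h1
  rw [← h1]
  exact (Int.castRingHom ℂ).map_det _

/-- As $\beta^{-1}=q(\beta)$ with $q$ integral, $q(M)$ is an integer inverse of $M$. This makes the
negative matrix powers in `Tpow` genuine inverses. -/
theorem isUnit_det_companion (hβ : IsPisotUnit β)
    (hb : (charPol β).map (Int.castRingHom ℂ) = ∏ i, (X - C (b i))) :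
    IsUnit (companion β).det := by
  obtain ⟨q, hq⟩ := exists_aeval_eq_inv hβ
  have h0 : β ≠ 0 := (zero_lt_one.trans hβ.one_lt).ne'
  have := aeval_companion_congr hβ hb (p := X * q) (q := 1) (by simp [hq, h0])
  rw [map_mul, aeval_X, map_one] at this
  exact Matrix.isUnit_det_of_right_inverse this

end Companion

/-! ### Greedy expansions and admissible sequences. -/

section Greedy

variable {β x : ℝ}

/-- The remainders of the greedy algorithm. -/
def greedyRem (β x : ℝ) (n : ℕ) : ℝ := (fun y : ℝ => Int.fract (β * y))^[n] x

theorem greedyRem_zero : greedyRem β x 0 = x := rfl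

theorem greedyRem_nonneg (hx : 0 ≤ x) (n : ℕ) : 0 ≤ greedyRem β x n := by
  cases n with
  | zero => exact hx
  | succ n => rw [greedyRem, Function.iterate_succ_apply']; exact Int.fract_nonneg _

theorem greedyRem_succ_lt_one (n : ℕ) : greedyRem β x (n + 1) < 1 := by
  rw [greedyRem, Function.iterate_succ_apply']; exact Int.fract_lt_one _

theorem greedyRem_lt_one (hx : x < 1) (n : ℕ) : greedyRem β x n < 1 := by
  cases n with
  | zero => exact hx
  | succ n => exact greedyRem_succ_lt_one n

theorem greedyRem_le_one (hx : x ≤ 1) (n : ℕ) : greedyRem β x n ≤ 1 := by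
  cases n with
  | zero => exact hx
  | succ n => exact (greedyRem_succ_lt_one n).le

theorem greedyRem_succ (hβ : 0 ≤ β) (hx : 0 ≤ x) (n : ℕ) :
    greedyRem β x (n + 1) = β * greedyRem β x n - greedyDigit β x n := by
  have h : 0 ≤ β * greedyRem β x n := mul_nonneg hβ (greedyRem_nonneg hx n)
  have h1 : greedyRem β x (n + 1) = Int.fract (β * greedyRem β x n) := by
    rw [greedyRem, Function.iterate_succ_apply']; rfl
  rw [h1, Int.fract, ← natCast_floor_eq_intCast_floor h]
  rfl

/-- Remainders of the quasi-greedy expansion of `1`. -/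
theorem exists_quasiGreedy_rem (hβ : 1 < β) :
    ∃ R : ℕ → ℝ, R 0 = 1 ∧ (∀ n, 0 ≤ R n ∧ R n ≤ 1) ∧
      ∀ n, R (n + 1) = β * R n - quasiGreedyOne β n := by
  have hβ0 : 0 ≤ β := by linarith
  by_cases h : EndsInZeros (greedyDigit β 1)
  · classical
    set k := Nat.find h with hk
    have hspec : ∀ n, k ≤ n → greedyDigit β 1 n = 0 := Nat.find_spec h
    have hd0 : greedyDigit β 1 0 ≠ 0 := by
      have h1 : (1 : ℕ) ≤ ⌊β * 1⌋₊ := Nat.le_floor (by simpa using hβ.le)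
      have h2 : greedyDigit β 1 0 = ⌊β * 1⌋₊ := rfl
      omega
    have hk0 : 0 < k := Nat.pos_of_ne_zero fun h0 => hd0 (hspec 0 (by omega))
    have hlast : greedyDigit β 1 (k - 1) ≠ 0 := by
      intro h0
      refine Nat.find_min h (m := k - 1) (by omega) fun n hn => ?_
      rcases eq_or_lt_of_le hn with rfl | hlt
      · exact h0
      · exact hspec n (by omega)
    -- From position `k` on all digits vanish, so a nonzero remainder would grow like $\beta^j$,
    -- although remainders never exceed 1.
    have hremk : greedyRem β 1 k = 0 := by
      by_contra hne
      have hpos : 0 < greedyRem β 1 k := lt_of_le_of_ne (greedyRem_nonneg zero_le_one k) (Ne.symm hne)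
      have hgrow : ∀ j, greedyRem β 1 (k + j) = β ^ j * greedyRem β 1 k := by
        intro j
        induction j with
        | zero => simp
        | succ j ih =>
          rw [← add_assoc, greedyRem_succ hβ0 zero_le_one, hspec _ (by omega), ih]
          push_cast; ring
      obtain ⟨j, hj⟩ := pow_unbounded_of_one_lt (1 / greedyRem β 1 k) hβ
      rw [div_lt_iff₀ hpos, ← hgrow] at hj
      exact absurd (greedyRem_le_one le_rfl (k + j)) (not_le.2 hj)
    -- Lowering the last digit of a period by one turns the final remainder 0 into 1, which restarts
    -- the expansion of 1.
    refine ⟨fun n => greedyRem β 1 (n % k), by simp [greedyRem_zero],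
      fun n => ⟨greedyRem_nonneg zero_le_one _, greedyRem_le_one le_rfl _⟩, fun n => ?_⟩
    have hlt := Nat.mod_lt n hk0
    simp only [quasiGreedyOne, dif_pos h, ← hk]
    by_cases hn : n % k + 1 = k
    · have h1 : (n + 1) % k = 0 := by
        rw [Nat.add_mod]
        rcases Nat.lt_or_ge 1 k with h2 | h2
        · rw [Nat.mod_eq_of_lt h2, hn, Nat.mod_self]
        · have : k = 1 := by omega
          simp [this, Nat.mod_one]
      have h3 := greedyRem_succ (x := 1) hβ0 zero_le_one (n % k)
      rw [hn, hremk] at h3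
      have h4 : greedyDigit β 1 (n % k) ≠ 0 := by
        rwa [show n % k = k - 1 by omega]
      rw [if_pos hn, h1, greedyRem_zero, Nat.cast_sub (by omega)]
      push_cast
      linarith
    · have h1 : (n + 1) % k = n % k + 1 := by
        rw [Nat.add_mod, Nat.mod_eq_of_lt (show 1 < k by omega), Nat.mod_eq_of_lt (by omega)]
      rw [if_neg hn, h1, greedyRem_succ hβ0 zero_le_one]
  · refine ⟨greedyRem β 1, rfl,
      fun n => ⟨greedyRem_nonneg zero_le_one _, greedyRem_le_one le_rfl _⟩, fun n => ?_⟩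
    rw [quasiGreedyOne, dif_neg h, greedyRem_succ hβ0 zero_le_one]

/-- Lexicographic comparison of two expansions through their remainders. -/
theorem lexLT_of_rem (hβ : 1 < β) {r R : ℕ → ℝ} {e d : ℕ → ℕ} (h0 : r 0 < R 0)
    (hr : ∀ n, 0 ≤ r n) (hR : ∀ n, R n ≤ 1)
    (hre : ∀ n, r (n + 1) = β * r n - e n) (hRd : ∀ n, R (n + 1) = β * R n - d n) :
    LexLT e d := by
  -- While the digits agree, the gap between remainders is multiplied by β; being at most 1, it
  -- forces a first disagreement.
  have hgrow : ∀ n, (∀ i < n, e i = d i) → R n - r n = β ^ n * (R 0 - r 0) := by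
    intro n
    induction n with
    | zero => simp
    | succ n ih =>
      intro h
      have := ih fun i hi => h i (by omega)
      rw [hre, hRd, h n (by omega), pow_succ', mul_assoc, ← this]
      ring
  have hex : ∃ n, e n ≠ d n := by
    by_contra! hall
    obtain ⟨n, hn⟩ := pow_unbounded_of_one_lt (1 / (R 0 - r 0)) hβ
    rw [div_lt_iff₀ (sub_pos.2 h0), ← hgrow n fun i _ => hall i] at hn
    linarith [hr n, hR n]
  classical
  refine ⟨Nat.find hex, fun i hi => not_not.1 (Nat.find_min hex hi), ?_⟩
  set n := Nat.find hex
  have hne : e n ≠ d n := Nat.find_spec hex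
  refine lt_of_le_of_ne ?_ hne
  have h1 := hgrow n fun i hi => not_not.1 (Nat.find_min hex hi)
  have h2 : 0 < R n - r n := by
    rw [h1]; exact mul_pos (pow_pos (by linarith) _) (sub_pos.2 h0)
  -- The recursions give $e_n-d_n\le 1-\beta(R_n-r_n)<1$.
  have h3 : (e n : ℝ) < d n + 1 := by
    have := mul_pos (show 0 < β by linarith) h2
    linarith [hr (n + 1), hR (n + 1), hre n, hRd n]
  exact Nat.lt_succ_iff.1 (by exact_mod_cast h3)

theorem greedy_tail_lexLT (hβ : 1 < β) (hx : 0 ≤ x) (hx1 : x < 1) (n : ℕ) :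
    LexLT (fun j => greedyDigit β x (n + j)) (quasiGreedyOne β) := by
  obtain ⟨R, hR0, hR, hRd⟩ := exists_quasiGreedy_rem hβ
  refine lexLT_of_rem hβ (r := fun j => greedyRem β x (n + j)) (R := R) ?_
    (fun j => greedyRem_nonneg hx _) (fun j => (hR j).2)
    (fun j => greedyRem_succ (by linarith) hx (n + j)) hRd
  rw [hR0]
  exact greedyRem_lt_one hx1 _

theorem quasiGreedyOne_zero_pos (hβ : 1 < β) : 0 < quasiGreedyOne β 0 := by
  obtain ⟨R, hR0, hR, hRd⟩ := exists_quasiGreedy_rem hβ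
  have h := hRd 0
  rw [hR0] at h
  have : (0 : ℝ) < quasiGreedyOne β 0 := by linarith [(hR (0 + 1)).2]
  exact_mod_cast this

/-- A lexicographically smaller sequence has first letter at most that of $d$. This uniform bound
drives every convergence and compactness argument for the codings. -/
theorem digit_le_of_mem_compactum {ε : ℤ → ℕ} (hε : ε ∈ compactum β) (k : ℤ) :
    ε k ≤ quasiGreedyOne β 0 := by
  obtain ⟨n, h1, h2⟩ := hε k
  rcases Nat.eq_zero_or_pos n with rfl | hn
  · simpa using h2.le
  · simpa using (h1 0 hn).le

theorem hasSum_greedy (hβ : 1 < β) (hx : 0 ≤ x) (hx1 : x < 1) :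
    HasSum (fun n => greedyDigit β x n * β⁻¹ ^ (n + 1)) x := by
  have hβ0 : 0 < β := by linarith
  have hpart : ∀ n, ∑ i ∈ Finset.range n, greedyDigit β x i * β⁻¹ ^ (i + 1) =
      x - greedyRem β x n * β⁻¹ ^ n := by
    intro n
    induction n with
    | zero => simp [greedyRem_zero]
    | succ n ih =>
      rw [Finset.sum_range_succ, ih, greedyRem_succ hβ0.le hx, pow_succ]
      field_simp
      ring
  rw [hasSum_iff_tendsto_nat_of_nonneg fun i => by positivity]
  simp only [hpart]
  have h0 : Filter.Tendsto (fun n => greedyRem β x n * β⁻¹ ^ n) Filter.atTop (nhds 0) := by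
    refine squeeze_zero (fun n => mul_nonneg (greedyRem_nonneg hx n) (by positivity))
      (fun n => mul_le_of_le_one_left (by positivity) (greedyRem_le_one hx1.le n))
      (tendsto_pow_atTop_nhds_zero_of_lt_one (by positivity) (inv_lt_one_of_one_lt₀ hβ))
  simpa using h0.const_sub x

/-- Every nonnegative real has a two-sided admissible expansion. -/
theorem exists_mem_compactum_hasSum (hβ : 1 < β) {s : ℝ} (hs : 0 ≤ s) :
    ∃ ε ∈ compactum β, HasSum (fun k : ℤ => ε k * β ^ (-k)) s := by
  have hβ0 : 0 < β := by linarith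
  obtain ⟨K, hK⟩ := pow_unbounded_of_one_lt s hβ
  set x := s / β ^ K with hxdef
  have hx : 0 ≤ x := by positivity
  have hx1 : x < 1 := (div_lt_one (by positivity)).2 hK
  -- The greedy digits of $s/\beta^K\in[0,1)$, moved `K` places to the left and preceded by zeros.
  refine ⟨fun k => if 1 ≤ k + K then greedyDigit β x (k + K - 1).toNat else 0, fun n => ?_, ?_⟩
  · by_cases hn : 1 ≤ n + K
    · convert greedy_tail_lexLT hβ hx hx1 (n + K - 1).toNat using 2 with j
      have hj : 1 ≤ n + j + K := by omega
      simp only [if_pos hj]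
      congr 1
      omega
    · exact ⟨0, by simp, by simpa [hn] using quasiGreedyOne_zero_pos hβ⟩
  · have h := (hasSum_greedy hβ hx hx1).mul_left (β ^ K)
    rw [hxdef, mul_div_cancel₀ _ (by positivity)] at h
    have hinj : Function.Injective fun n : ℕ => (n : ℤ) + 1 - K := fun a b hab => by
      simp only at hab; omega
    rw [← hinj.hasSum_iff]
    · convert! h using 2 with n
      have h1 : (1 : ℤ) ≤ n + 1 - K + K := by omega
      have h2 : ((n : ℤ) + 1 - K + K - 1).toNat = n := by omega
      simp only [Function.comp, h1, if_true, h2]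
      rw [show -((n : ℤ) + 1 - K) = K - (n + 1 : ℕ) by push_cast; ring, zpow_sub₀ hβ0.ne',
        zpow_natCast, zpow_natCast, inv_pow]
      ring
    · intro k hk
      have : ¬ 1 ≤ k + K := fun h => hk ⟨(k + K - 1).toNat, by simp only; omega⟩
      simp [this]

/-- A limit of admissible sequences which is not admissible has a tail equal to the quasi-greedy
expansion of `1`. -/
theorem exists_tail_eq_of_mem_closure {ε : ℤ → ℕ} (hε : ε ∈ closure (compactum β))
    (hne : ε ∉ compactum β) : ∃ n : ℤ, ∀ j : ℕ, ε (n + j) = quasiGreedyOne β j := by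
  simp only [compactum, Set.mem_ofPred_eq, not_forall] at hne
  obtain ⟨n, hn⟩ := hne
  refine ⟨n, ?_⟩
  by_contra! hex
  classical
  set j := Nat.find hex
  have hj : ε (n + j) ≠ quasiGreedyOne β j := Nat.find_spec hex
  have hlt : ∀ i < j, ε (n + i) = quasiGreedyOne β i := fun i hi => not_not.1 (Nat.find_min hex hi)
  have hgt : quasiGreedyOne β j < ε (n + j) :=
    lt_of_le_of_ne (not_lt.1 fun h => hn ⟨j, hlt, h⟩) hj.symm
  -- The tail of `ε` first leaves $d$ at `j`, and upwards. The open cylinder fixing these letters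
  -- would have to contain an admissible sequence, which is impossible.
  have hopen : IsOpen {η : ℤ → ℕ | ∀ i ∈ Finset.range (j + 1), η (n + i) = ε (n + i)} := by
    simp only [Set.ofPred_forall]
    refine isOpen_biInter_finset fun i _ => ?_
    exact (isOpen_discrete ({ε (n + i)} : Set ℕ)).preimage
      (continuous_apply (n + (i : ℤ)) : Continuous fun η : ℤ → ℕ => η (n + i))
  obtain ⟨η, h1, h2⟩ := mem_closure_iff.1 hε _ hopen fun i _ => rfl
  obtain ⟨k, hk1, hk2⟩ := h2 n
  simp only at hk1 hk2
  have hη : ∀ i ≤ j, η (n + i) = ε (n + i) := fun i hi => h1 i (Finset.mem_range.2 (by omega))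
  rcases lt_trichotomy k j with h | h | h
  · rw [hη k h.le, hlt k h] at hk2
    exact lt_irrefl _ hk2
  · rw [h, hη j le_rfl] at hk2
    exact lt_asymm hgt hk2
  · have := hk1 j h
    rw [hη j le_rfl] at this
    exact hj this

end Greedy

/-! ### Equidistribution and density of a ray in the torus. -/

section Density

open Filter Topology UnitAddTorus

variable {m : ℕ}

/-- The projection `ℝ^m → ℝ^m / ℤ^m`. -/
def proj (m : ℕ) : (Fin m → ℝ) →+ Torus m where
  toFun x i := (x i : UnitAddCircle)
  map_zero' := by ext; simp
  map_add' x y := by ext; simp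

theorem proj_apply (x : Fin m → ℝ) (i : Fin m) : proj m x i = (x i : UnitAddCircle) := rfl

theorem continuous_proj : Continuous (proj m) :=
  continuous_pi fun i => (AddCircle.continuous_mk' 1).comp (continuous_apply i)

theorem mFourier_proj (n : Fin m → ℤ) (x : Fin m → ℝ) :
    mFourier n (proj m x) = Complex.exp (2 * Real.pi * Complex.I * ((∑ i, n i * x i : ℝ) : ℂ)) := by
  simp only [mFourier, ContinuousMap.coe_mk, proj_apply, fourier_coe_apply]
  rw [← Complex.exp_sum, Complex.ofReal_sum, Finset.mul_sum]
  refine congrArg _ (Finset.sum_congr rfl fun i _ => ?_)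
  push_cast; ring

theorem volume_real_univ_torus : (volume : Measure (Torus m)).real Set.univ = 1 := by
  rw [Measure.real, volume_pi, Measure.pi_univ]
  simp

theorem integral_mFourier_eq_zero {n : Fin m → ℤ} (hn : n ≠ 0) :
    ∫ x : Torus m, mFourier n x = 0 := by
  obtain ⟨i, hi⟩ : ∃ i, n i ≠ 0 := by simpa [funext_iff] using hn
  -- Translation by half a period in a coordinate with $n_i\ne0$ changes the sign of the character.
  refine integral_eq_zero_of_add_right_eq_neg (g := proj m (Pi.single i (1 / (2 * n i)))) fun x => ?_
  obtain ⟨y, rfl⟩ : ∃ y, proj m y = x := by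
    choose y hy using fun i => QuotientAddGroup.mk_surjective (x i)
    exact ⟨y, funext hy⟩
  rw [← map_add, mFourier_proj, mFourier_proj]
  have hs : ∑ j, (n j : ℝ) * Pi.single (M := fun _ => ℝ) i (1 / (2 * n i)) j = 1 / 2 := by
    rw [Finset.sum_eq_single i]
    · have : (n i : ℝ) ≠ 0 := by exact_mod_cast hi
      rw [Pi.single_eq_same]; field_simp
    · intro j _ hj; simp [hj]
    · simp
  have : (2 * Real.pi * Complex.I * ((∑ j, (n j : ℝ) *
      (y + Pi.single i (1 / (2 * n i : ℝ)) : Fin m → ℝ) j : ℝ) : ℂ)) =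
      2 * Real.pi * Complex.I * ((∑ j, (n j : ℝ) * y j : ℝ) : ℂ) + Real.pi * Complex.I := by
    simp only [Pi.add_apply, mul_add, Finset.sum_add_distrib, hs]
    push_cast; ring
  rw [this, Complex.exp_add, Complex.exp_pi_mul_I, mul_neg_one]

theorem tendsto_average_mFourier {v : Fin m → ℝ}
    (hv : ∀ n : Fin m → ℤ, n ≠ 0 → ∑ i, n i * v i ≠ 0) (n : Fin m → ℤ) :
    Tendsto (fun S : ℝ => (S⁻¹ : ℂ) * ∫ s in (0 : ℝ)..S, mFourier n (proj m (s • v))) atTop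
      (𝓝 (∫ x : Torus m, mFourier n x)) := by
  by_cases hn : n = 0
  · subst hn
    simp only [mFourier_zero, ContinuousMap.one_apply, intervalIntegral.integral_const,
      integral_const]
    rw [volume_real_univ_torus, one_smul]
    refine (tendsto_const_nhds (x := (1 : ℂ))).congr' ?_
    filter_upwards [eventually_gt_atTop 0] with S hS
    have : (S : ℂ) ≠ 0 := by exact_mod_cast hS.ne'
    simp [this]
  · rw [integral_mFourier_eq_zero hn]
    set c : ℂ := 2 * Real.pi * Complex.I * ((∑ i, n i * v i : ℝ) : ℂ) with hc
    have hc0 : c ≠ 0 := by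
      have := hv n hn
      simp only [hc]
      refine mul_ne_zero Complex.two_pi_I_ne_zero (by exact_mod_cast this)
    have h1 : ∀ s : ℝ, mFourier n (proj m (s • v)) = Complex.exp (c * s) := fun s => by
      rw [mFourier_proj, hc]
      rw [mul_assoc _ _ (s : ℂ), ← Complex.ofReal_mul, Finset.sum_mul]
      simp only [Pi.smul_apply, smul_eq_mul, mul_assoc, mul_comm s]
    simp only [h1, integral_exp_mul_complex hc0]
    refine squeeze_zero_norm' (a := fun S : ℝ => S⁻¹ * (2 / ‖c‖)) ?_ ?_
    · filter_upwards [eventually_gt_atTop 0] with S hS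
      have h2 : ∀ s : ℝ, ‖Complex.exp (c * s)‖ = 1 := fun s => by
        rw [show c * s = ((2 * Real.pi * (∑ i, n i * v i) * s : ℝ) : ℂ) * Complex.I by
          rw [hc]; push_cast; ring, Complex.norm_exp_ofReal_mul_I]
      rw [norm_mul, norm_div, norm_inv, Complex.norm_real, Real.norm_of_nonneg hS.le]
      gcongr
      refine (norm_sub_le _ _).trans ?_
      rw [h2, h2]; norm_num
    · simpa using tendsto_inv_atTop_zero.mul_const (2 / ‖c‖)

theorem tendsto_average_of_mem_span {v : Fin m → ℝ}
    (hv : ∀ n : Fin m → ℤ, n ≠ 0 → ∑ i, n i * v i ≠ 0) {P : C(Torus m, ℂ)}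
    (hP : P ∈ Submodule.span ℂ (Set.range (mFourier (d := Fin m)))) :
    Tendsto (fun S : ℝ => (S⁻¹ : ℂ) * ∫ s in (0 : ℝ)..S, P (proj m (s • v))) atTop
      (𝓝 (∫ x : Torus m, P x)) := by
  have hint : ∀ (Q : C(Torus m, ℂ)) (S : ℝ),
      IntervalIntegrable (fun s : ℝ => Q (proj m (s • v))) volume 0 S := fun Q S =>
    (Q.continuous.comp (continuous_proj.comp
      (continuous_id.smul continuous_const))).intervalIntegrable _ _
  have hint' : ∀ Q : C(Torus m, ℂ), Integrable (fun x => Q x) volume := fun Q =>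
    Q.continuous.integrable_of_hasCompactSupport (HasCompactSupport.of_compactSpace _)
  induction hP using Submodule.span_induction with
  | mem P h => obtain ⟨n, rfl⟩ := h; exact tendsto_average_mFourier hv n
  | zero => simp
  | add P Q _ _ hP hQ =>
    simp only [ContinuousMap.add_apply]
    rw [integral_add (hint' P) (hint' Q)]
    refine (hP.add hQ).congr fun S => ?_
    rw [intervalIntegral.integral_add (hint P S) (hint Q S)]
    ring
  | smul a P _ hP =>
    simp only [ContinuousMap.smul_apply, smul_eq_mul, integral_const_mul,
      intervalIntegral.integral_const_mul]
    refine (hP.const_mul a).congr fun S => ?_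
    ring

/-- Kronecker's theorem for a half-line in the torus. -/
theorem dense_proj_ray {v : Fin m → ℝ}
    (hv : ∀ n : Fin m → ℤ, n ≠ 0 → ∑ i, n i * v i ≠ 0) :
    Dense ((fun s : ℝ => proj m (s • v)) '' Set.Ici 0) := by
  set F := closure ((fun s : ℝ => proj m (s • v)) '' Set.Ici 0) with hF
  have hmem : ∀ s : ℝ, 0 ≤ s → proj m (s • v) ∈ F := fun s hs => subset_closure ⟨s, hs, rfl⟩
  by_contra hd
  obtain ⟨x₀, hx₀⟩ : ∃ x, x ∉ F := by
    by_contra! h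
    exact hd h
  have hFne : F.Nonempty := ⟨_, hmem 0 le_rfl⟩
  have hcont : Continuous fun x : Torus m => Metric.infDist x F := Metric.continuous_infDist_pt F
  set I := ∫ x : Torus m, Metric.infDist x F with hI
  have hIpos : 0 < I := hcont.integral_pos_of_hasCompactSupport_nonneg_nonzero
    (HasCompactSupport.of_compactSpace _) (fun x => Metric.infDist_nonneg)
    (x := x₀) ((isClosed_closure.notMem_iff_infDist_pos hFne).1 hx₀).ne'
  let f : C(Torus m, ℂ) := ⟨fun x => (Metric.infDist x F : ℂ),
    Complex.continuous_ofReal.comp hcont⟩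
  -- The distance to the closed ray vanishes along the ray but has integral `I > 0`. A trigonometric
  -- polynomial closer than `I / 2` to it has ray averages at most `I / 2`, hence an integral at
  -- most `I / 2`, so `I < I`.
  have hf : f ∈ (Submodule.span ℂ (Set.range (mFourier (d := Fin m)))).topologicalClosure := by
    rw [span_mFourier_closure_eq_top]; trivial
  obtain ⟨P, hP, hPf⟩ := Metric.mem_closure_iff.1 hf (I / 2) (by linarith)
  have hlim := tendsto_average_of_mem_span hv hP
  have hbound : ∀ x, ‖f x - P x‖ ≤ I / 2 := fun x => by
    rw [← dist_eq_norm]; exact (ContinuousMap.dist_apply_le_dist x).trans hPf.le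
  have h1 : ‖∫ x : Torus m, P x‖ ≤ I / 2 := by
    refine le_of_tendsto hlim.norm ?_
    filter_upwards [eventually_gt_atTop 0] with S hS
    have h2 : ‖∫ s in (0 : ℝ)..S, P (proj m (s • v))‖ ≤ I / 2 * |S - 0| := by
      refine intervalIntegral.norm_integral_le_of_norm_le_const fun s hs => ?_
      rw [Set.uIoc_of_le hS.le] at hs
      have h3 := hbound (proj m (s • v))
      have h4 : f (proj m (s • v)) = 0 := by
        simp [f, Metric.infDist_zero_of_mem (hmem s hs.1.le)]
      rwa [h4, zero_sub, norm_neg] at h3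
    rw [sub_zero, abs_of_pos hS] at h2
    rw [norm_mul, norm_inv, Complex.norm_real, Real.norm_of_nonneg hS.le]
    calc S⁻¹ * _ ≤ S⁻¹ * (I / 2 * S) := by gcongr
      _ = I / 2 := by field_simp
  have hint' : ∀ Q : C(Torus m, ℂ), Integrable (fun x => Q x) volume := fun Q =>
    Q.continuous.integrable_of_hasCompactSupport (HasCompactSupport.of_compactSpace _)
  have h2 : ‖∫ x : Torus m, (f x - P x)‖ ≤ dist f P := by
    have := norm_integral_le_of_norm_le_const (μ := (volume : Measure (Torus m)))
      (f := fun x => f x - P x) (C := dist f P) (ae_of_all _ fun x => by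
        rw [← dist_eq_norm]; exact ContinuousMap.dist_apply_le_dist x)
    rwa [volume_real_univ_torus, mul_one] at this
  rw [integral_sub (hint' f) (hint' P)] at h2
  have h3 : ∫ x : Torus m, f x = (I : ℂ) := by
    rw [hI, ← integral_complex_ofReal]; rfl
  have h4 : ‖(I : ℂ)‖ ≤ ‖(I : ℂ) - ∫ x : Torus m, P x‖ + ‖∫ x : Torus m, P x‖ := by
    simpa using norm_add_le ((I : ℂ) - ∫ x : Torus m, P x) (∫ x : Torus m, P x)
  rw [h3] at h2
  rw [Complex.norm_real, Real.norm_of_nonneg hIpos.le] at h4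
  linarith

end Density

/-! ### Projected hyperplanes are null. -/

section NullSets

variable {m : ℕ}

theorem exists_int_of_proj_eq {x y : Fin m → ℝ} (h : proj m x = proj m y) :
    ∃ z : Fin m → ℤ, ∀ i, x i = y i + z i := by
  have : ∀ i, ∃ n : ℤ, x i = y i + n := fun i => by
    have h1 := congrFun h i
    rw [proj_apply, proj_apply, ← sub_eq_zero, ← AddCircle.coe_sub, AddCircle.coe_eq_zero_iff] at h1
    obtain ⟨n, hn⟩ := h1
    exact ⟨n, by simp at hn; linarith⟩
  choose z hz using this
  exact ⟨z, hz⟩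

theorem volume_hyperplane {l : Fin m → ℝ} (hl : l ≠ 0) (c : ℝ) :
    volume {x : Fin m → ℝ | ∑ i, l i * x i = c} = 0 := by
  obtain ⟨i, hi⟩ : ∃ i, l i ≠ 0 := by simpa [funext_iff] using hl
  let L : (Fin m → ℝ) →ₗ[ℝ] ℝ := ∑ i, l i • LinearMap.proj i
  have hL : ∀ x, L x = ∑ i, l i * x i := fun x => by simp [L]
  have h0 : volume (LinearMap.ker L : Set (Fin m → ℝ)) = 0 := by
    refine Measure.addHaar_submodule _ _ fun htop => hi ?_
    have : L (Pi.single i 1) = 0 := by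
      rw [← LinearMap.mem_ker, htop]; trivial
    rw [hL, Finset.sum_eq_single i] at this
    · simpa using this
    · intro j _ hj; simp [hj]
    · simp
  have h1 : {x : Fin m → ℝ | ∑ i, l i * x i = c} =
      (fun x => x + Pi.single i (-c / l i)) ⁻¹' (LinearMap.ker L : Set (Fin m → ℝ)) := by
    ext x
    have h2 : L (Pi.single i (-c / l i)) = -c := by
      rw [hL, Finset.sum_eq_single i]
      · simp; field_simp
      · intro j _ hj; simp [hj]
      · simp
    simp only [Set.mem_ofPred_eq, Set.mem_preimage, SetLike.mem_coe, LinearMap.mem_ker, map_add, h2]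
    rw [hL]
    constructor <;> intro h <;> linarith
  rw [h1, measure_preimage_add_right, h0]

theorem measurePreserving_proj :
    MeasurePreserving (proj m)
      (volume.restrict (Set.univ.pi fun _ : Fin m => Set.Ioc (0 : ℝ) (0 + 1))) volume := by
  have h := measurePreserving_pi (fun _ : Fin m => volume.restrict (Set.Ioc (0 : ℝ) (0 + 1)))
    (fun _ => (volume : Measure UnitAddCircle)) (fun _ => UnitAddCircle.measurePreserving_mk 0)
  rw [volume_pi, Measure.restrict_pi_pi]
  exact h

/-- The projection is cut into compact pieces, to have measurable sets. The preimage of each lies in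
the countably many integer translates of the hyperplane. -/
theorem volume_proj_hyperplane {l : Fin m → ℝ} (hl : l ≠ 0) (c : ℝ) :
    volume (proj m '' {x | ∑ i, l i * x i = c}) = 0 := by
  have hclosed : IsClosed {x : Fin m → ℝ | ∑ i, l i * x i = c} :=
    isClosed_eq (by fun_prop) continuous_const
  have hcov : proj m '' {x | ∑ i, l i * x i = c} ⊆
      ⋃ r : ℕ, proj m '' ({x | ∑ i, l i * x i = c} ∩ Metric.closedBall 0 r) := by
    rintro _ ⟨x, hx, rfl⟩
    obtain ⟨r, hr⟩ := exists_nat_ge ‖x‖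
    exact Set.mem_iUnion.2 ⟨r, x, ⟨hx, by simpa using hr⟩, rfl⟩
  refine measure_mono_null hcov (measure_iUnion_null fun r => ?_)
  have hcomp : IsCompact (proj m '' ({x | ∑ i, l i * x i = c} ∩ Metric.closedBall 0 r)) :=
    ((isCompact_closedBall 0 (r : ℝ)).inter_left hclosed).image continuous_proj
  rw [← measurePreserving_proj.measure_preimage hcomp.measurableSet.nullMeasurableSet]
  refine measure_mono_null ?_ ((Measure.absolutelyContinuous_of_le Measure.restrict_le_self)
    (measure_iUnion_null fun z : Fin m → ℤ => volume_hyperplane hl (c + ∑ i, l i * z i)))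
  rintro x ⟨y, ⟨hy, -⟩, hxy⟩
  obtain ⟨z, hz⟩ := exists_int_of_proj_eq hxy.symm
  refine Set.mem_iUnion.2 ⟨z, ?_⟩
  simp only [Set.mem_ofPred_eq] at hy ⊢
  rw [← hy, ← Finset.sum_add_distrib]
  exact Finset.sum_congr rfl fun i _ => by rw [hz]; ring

end NullSets

/-! ### Integer matrices acting on the torus. -/

section ToralEnd

variable {m : ℕ}

theorem toralEnd_apply (N : Matrix (Fin m) (Fin m) ℤ) (x : Torus m) (i : Fin m) :
    toralEnd N x i = ∑ j, N i j • x j := rfl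

/-- Integer matrices act on the torus by a ring homomorphism. -/
def toralEndHom (m : ℕ) : Matrix (Fin m) (Fin m) ℤ →+* AddMonoid.End (Torus m) where
  toFun := toralEnd
  map_one' := by
    ext x i
    simp [toralEnd_apply, Matrix.one_apply, ite_smul]
  map_mul' N N' := by
    refine AddMonoidHom.ext fun x => funext fun i => ?_
    change toralEnd (N * N') x i = toralEnd N (toralEnd N' x) i
    simp only [toralEnd_apply, Matrix.mul_apply, Finset.smul_sum, Finset.sum_smul, mul_smul]
    exact Finset.sum_comm
  map_zero' := by
    refine AddMonoidHom.ext fun x => funext fun i => ?_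
    change ∑ j, (0 : Matrix (Fin m) (Fin m) ℤ) i j • x j = 0
    simp
  map_add' N N' := by
    refine AddMonoidHom.ext fun x => funext fun i => ?_
    change toralEnd (N + N') x i = toralEnd N x i + toralEnd N' x i
    simp [toralEnd_apply, add_smul, Finset.sum_add_distrib]

theorem toralEnd_mul_apply (N N' : Matrix (Fin m) (Fin m) ℤ) (x : Torus m) :
    toralEnd (N * N') x = toralEnd N (toralEnd N' x) :=
  DFunLike.congr_fun (map_mul (toralEndHom m) N N') x

theorem aeval_toralEnd (N : Matrix (Fin m) (Fin m) ℤ) (p : ℤ[X]) :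
    aeval (toralEnd N) p = toralEnd (aeval N p) :=
  Polynomial.aeval_algHom_apply (toralEndHom m).toIntAlgHom N p

theorem continuous_toralEnd (N : Matrix (Fin m) (Fin m) ℤ) : Continuous (toralEnd N) :=
  continuous_pi fun i => by
    simp only [toralEnd_apply]
    fun_prop

theorem toralEnd_proj (N : Matrix (Fin m) (Fin m) ℤ) (x : Fin m → ℝ) :
    toralEnd N (proj m x) = proj m fun i => ∑ j, N i j * x j := by
  funext i
  rw [toralEnd_apply, proj_apply, ← QuotientAddGroup.mk'_apply, map_sum]
  refine Finset.sum_congr rfl fun j _ => ?_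
  rw [← zsmul_eq_mul, map_zsmul]
  rfl

/-- If an entry in column `j` differs by $c\ne0$, the point with $j$-th coordinate $1/(2c)$ and
zeros elsewhere gets images that differ by $1/2$ in one coordinate. -/
theorem toralEnd_injective : Function.Injective fun N : Matrix (Fin m) (Fin m) ℤ =>
    (toralEnd N : Torus m → Torus m) := by
  intro N N' h
  ext i j
  by_contra hne
  have hc : ((N i j - N' i j : ℤ) : ℝ) ≠ 0 := by exact_mod_cast sub_ne_zero.2 hne
  have h1 := congrFun h (proj m (Pi.single j (1 / (2 * ((N i j - N' i j : ℤ) : ℝ)))))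
  simp only [toralEnd_proj] at h1
  obtain ⟨z, hz⟩ := exists_int_of_proj_eq h1
  have h2 := hz i
  simp only [Pi.single_apply, mul_ite, mul_zero, Finset.sum_ite_eq', Finset.mem_univ,
    if_true] at h2
  have h3 : (1 : ℝ) = 2 * z i := by
    have h4 : ((N i j - N' i j : ℤ) : ℝ) * (1 / (2 * ((N i j - N' i j : ℤ) : ℝ))) = z i := by
      push_cast at h2 ⊢; linarith
    rw [← h4]; field_simp
  have h5 : (1 : ℤ) = 2 * z i := by exact_mod_cast h3
  omega

end ToralEnd

/-! ### Action of T on the points (ξ, ξβ⁻¹, …). -/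

section Homoclinic

variable {β : ℝ} {b : Fin (deg β) → ℂ}

theorem homoclinic_eq_proj (β ξ : ℝ) :
    homoclinic β ξ = proj (deg β) fun i => ξ * β⁻¹ ^ (i : ℕ) := rfl

theorem homoclinic_add (ξ η : ℝ) : homoclinic β (ξ + η) = homoclinic β ξ + homoclinic β η := by
  simp only [homoclinic_eq_proj, ← map_add]
  congr 1; funext i; simp [add_mul]

theorem homoclinic_zsmul (a : ℤ) (ξ : ℝ) : homoclinic β (a * ξ) = a • homoclinic β ξ := by
  simp only [homoclinic_eq_proj, ← map_zsmul]
  congr 1; funext i; simp [mul_assoc]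

theorem toralEnd_companion_homoclinic (hβ : IsPisotUnit β) (ξ : ℝ) :
    toralEnd (companion β) (homoclinic β ξ) = homoclinic β (β * ξ) := by
  have h0 : β ≠ 0 := (zero_lt_one.trans hβ.one_lt).ne'
  rw [homoclinic_eq_proj, homoclinic_eq_proj, toralEnd_proj]
  congr 1
  funext i
  have := sum_companion_mul hβ.isIntegral h0 (minpoly.aeval ℤ β) i
  rw [mul_comm β, mul_assoc, ← this, Finset.mul_sum]
  exact Finset.sum_congr rfl fun j _ => by ring

/-- The eigenvector relation descends to the torus. With $p=g'$ and $\xi=\xi_0$ it carries $t_0$ to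
$t$. -/
theorem toralEnd_aeval_homoclinic (hβ : IsPisotUnit β) (p : ℤ[X]) (ξ : ℝ) :
    toralEnd (aeval (companion β) p) (homoclinic β ξ) = homoclinic β (aeval β p * ξ) := by
  induction p using Polynomial.induction_on' with
  | add p q hp hq =>
    rw [map_add, map_add, add_mul, homoclinic_add, ← hp, ← hq]
    exact DFunLike.congr_fun (map_add (toralEndHom _) _ _) _
  | monomial n a =>
    have hpow : toralEnd (companion β ^ n) (homoclinic β ξ) = homoclinic β (β ^ n * ξ) := by
      induction n with
      | zero =>
        rw [pow_zero, pow_zero, one_mul]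
        exact DFunLike.congr_fun (map_one (toralEndHom _)) _
      | succ n ih =>
        rw [pow_succ', toralEnd_mul_apply, ih, toralEnd_companion_homoclinic hβ, pow_succ',
          mul_assoc]
    rw [aeval_monomial, aeval_monomial, mul_assoc, eq_intCast, eq_intCast, homoclinic_zsmul, ← hpow,
      ← zsmul_eq_mul]
    exact DFunLike.congr_fun (map_zsmul (toralEndHom _) a _) _

theorem Tpow_homoclinic (hβ : IsPisotUnit β)
    (hb : (charPol β).map (Int.castRingHom ℂ) = ∏ i, (X - C (b i))) (k : ℤ) (ξ : ℝ) :
    Tpow β k (homoclinic β ξ) = homoclinic β (ξ * β ^ k) := by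
  have h0 : β ≠ 0 := (zero_lt_one.trans hβ.one_lt).ne'
  have hdet := isUnit_det_companion hβ hb
  have hstep : ∀ (k : ℤ) (ξ : ℝ),
      Tpow β (k + 1) (homoclinic β ξ) = Tpow β k (homoclinic β (β * ξ)) := fun k ξ => by
    rw [Tpow, Matrix.zpow_add_one hdet, toralEnd_mul_apply, toralEnd_companion_homoclinic hβ, Tpow]
  induction k using Int.induction_on generalizing ξ with
  | zero =>
    rw [Tpow, zpow_zero, zpow_zero, mul_one]
    exact DFunLike.congr_fun (map_one (toralEndHom _)) _
  | succ k ih => rw [hstep, ih, zpow_add_one₀ h0]; congr 1; ring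
  | pred k ih =>
    have := hstep (-k - 1) (β⁻¹ * ξ)
    rw [sub_add_cancel, mul_inv_cancel_left₀ h0, ih] at this
    rw [← this, zpow_sub_one₀ h0]; congr 1; ring

theorem codingTerm_eq (hβ : IsPisotUnit β)
    (hb : (charPol β).map (Int.castRingHom ℂ) = ∏ i, (X - C (b i))) (ξ : ℝ) (ε : ℤ → ℕ) (k : ℤ) :
    codingTerm β ξ ε k = proj (deg β) fun i => ε k * (ξ * β ^ (-k - (i : ℕ))) := by
  have h0 : β ≠ 0 := (zero_lt_one.trans hβ.one_lt).ne'
  rw [codingTerm, Tpow_homoclinic hβ hb, homoclinic_eq_proj, ← map_nsmul]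
  congr 1
  funext i
  rw [Pi.smul_apply, nsmul_eq_mul, zpow_sub₀ h0, zpow_natCast, inv_pow]
  ring

theorem toralEnd_codingTerm (hβ : IsPisotUnit β)
    (hb : (charPol β).map (Int.castRingHom ℂ) = ∏ i, (X - C (b i))) (p : ℤ[X]) (ξ : ℝ)
    (ε : ℤ → ℕ) (k : ℤ) :
    toralEnd (aeval (companion β) p) (codingTerm β ξ ε k) =
      codingTerm β (aeval β p * ξ) ε k := by
  rw [codingTerm, codingTerm, map_nsmul, Tpow_homoclinic hβ hb, Tpow_homoclinic hβ hb,
    toralEnd_aeval_homoclinic hβ, mul_assoc]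

end Homoclinic

/-! ### Convergence, continuity and almost sure surjectivity of φ₀. -/

section Coding

variable {β : ℝ} {b : Fin (deg β) → ℂ}

/-- A lift to `ℝ^m` of the terms of `φ₀`: the powers `ξ₀ β^j` are corrected by the integers `u j`
for positions left of `n`. -/
def liftTerm (β : ℝ) (u : ℤ → ℤ) (n : ℤ) (ε : ℤ → ℕ) (k : ℤ) : Fin (deg β) → ℝ :=
  fun i => ε k * (xi₀ β * β ^ (-k - (i : ℕ)) - if k < n then (u (-k - (i : ℕ)) : ℝ) else 0)

theorem proj_liftTerm (hβ : IsPisotUnit β)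
    (hb : (charPol β).map (Int.castRingHom ℂ) = ∏ i, (X - C (b i))) (u : ℤ → ℤ) (n : ℤ)
    (ε : ℤ → ℕ) (k : ℤ) : proj (deg β) (liftTerm β u n ε k) = codingTerm β (xi₀ β) ε k := by
  rw [codingTerm_eq hβ hb, ← sub_eq_zero, ← map_sub]
  funext i
  rw [proj_apply, Pi.zero_apply, AddCircle.coe_eq_zero_iff]
  by_cases hk : k < n
  · refine ⟨-(ε k * u (-k - (i : ℕ))), ?_⟩
    simp [liftTerm, hk]; ring
  · exact ⟨0, by simp [liftTerm, hk]⟩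

/-- Two geometric tails: $\beta^{-k}$ to the right, and the integer approximation error $\rho^{|k|}$
to the left. -/
theorem summable_liftWeight (hβ : 1 < β) {u : ℤ → ℤ} {K ρ : ℝ} (hρ : 0 < ρ) (hρ1 : ρ < 1)
    (hu : ∀ n : ℕ, |xi₀ β * β ^ (n : ℤ) - u n| ≤ K * ρ ^ n) (n : ℤ) (i : ℕ) :
    Summable fun k : ℤ => |xi₀ β * β ^ (-k - (i : ℤ)) - if k < n then (u (-k - i) : ℝ) else 0| := by
  have hβ0 : 0 < β := by linarith
  rw [summable_int_iff_summable_nat_and_neg]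
  constructor
  · refine Summable.of_norm_bounded_eventually_nat (g := fun k => |xi₀ β| * β⁻¹ ^ i * β⁻¹ ^ k)
      ((summable_geometric_of_lt_one (by positivity) (inv_lt_one_of_one_lt₀ hβ)).mul_left _) ?_
    filter_upwards [Filter.eventually_ge_atTop n.toNat] with k hk
    rw [if_neg (by omega), sub_zero, Real.norm_eq_abs, abs_abs, abs_mul,
      abs_of_pos (zpow_pos hβ0 _), zpow_sub₀ hβ0.ne', zpow_neg, zpow_natCast, zpow_natCast]
    simp only [inv_pow]
    apply le_of_eq
    field_simp
  · refine Summable.of_norm_bounded_eventually_nat (g := fun k => K * ρ⁻¹ ^ i * ρ ^ k)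
      ((summable_geometric_of_lt_one hρ.le hρ1).mul_left _) ?_
    filter_upwards [Filter.eventually_ge_atTop ((-n).toNat + 1 + i)] with k hk
    have h1 : - -(k : ℤ) - (i : ℤ) = (k - i : ℕ) := by omega
    rw [if_pos (by omega), h1, Real.norm_eq_abs, abs_abs]
    refine (hu (k - i)).trans (le_of_eq ?_)
    rw [show k = (k - i) + i by omega, pow_add, Nat.add_sub_cancel, inv_pow]
    field_simp

theorem exists_liftTerm_bound (hβ : 1 < β) {u : ℤ → ℤ} {K ρ : ℝ} (hρ : 0 < ρ) (hρ1 : ρ < 1)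
    (hu : ∀ n : ℕ, |xi₀ β * β ^ (n : ℤ) - u n| ≤ K * ρ ^ n) (n : ℤ) (D : ℕ) :
    ∃ B : ℤ → ℝ, Summable B ∧ ∀ ε : ℤ → ℕ, (∀ k, ε k ≤ D) → ∀ k, ‖liftTerm β u n ε k‖ ≤ B k := by
  refine ⟨fun k => D * ∑ i : Fin (deg β),
    |xi₀ β * β ^ (-k - ((i : ℕ) : ℤ)) - if k < n then (u (-k - (i : ℕ)) : ℝ) else 0|,
    (summable_sum fun (i : Fin (deg β)) _ =>
      summable_liftWeight hβ hρ hρ1 hu n (i : ℕ)).mul_left _, fun ε hε k => ?_⟩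
  have hε' : (ε k : ℝ) ≤ D := by exact_mod_cast hε k
  refine (pi_norm_le_iff_of_nonneg (by positivity)).2 fun i => ?_
  rw [liftTerm, Real.norm_eq_abs, abs_mul, Nat.abs_cast]
  refine mul_le_mul hε' ?_ (abs_nonneg _) (by positivity)
  exact Finset.single_le_sum (f := fun i : Fin (deg β) =>
    |xi₀ β * β ^ (-k - ((i : ℕ) : ℤ)) - if k < n then (u (-k - (i : ℕ)) : ℝ) else 0|)
    (fun _ _ => abs_nonneg _) (Finset.mem_univ i)

theorem norm_proj_le {m : ℕ} (x : Fin m → ℝ) : ‖proj m x‖ ≤ ‖x‖ :=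
  (pi_norm_le_iff_of_nonneg (norm_nonneg _)).2 fun i =>
    (QuotientAddGroup.norm_mk_le_norm).trans (norm_le_pi_norm x i)

theorem summable_codingTerm (hβ : IsPisotUnit β)
    (hb : (charPol β).map (Int.castRingHom ℂ) = ∏ i, (X - C (b i))) {ε : ℤ → ℕ} {D : ℕ}
    (hε : ∀ k, ε k ≤ D) : Summable (codingTerm β (xi₀ β) ε) := by
  obtain ⟨u, K, ρ, l, hρ, hρ1, -, hu, -⟩ := exists_trace_sequence hβ hb
  obtain ⟨B, hB, hle⟩ := exists_liftTerm_bound hβ.one_lt hρ hρ1 hu 0 D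
  exact ((Summable.of_norm_bounded hB (hle ε hε)).map (proj (deg β)) continuous_proj).congr
    fun k => proj_liftTerm hβ hb u 0 ε k

theorem continuousOn_phi₀ (hβ : IsPisotUnit β)
    (hb : (charPol β).map (Int.castRingHom ℂ) = ∏ i, (X - C (b i))) (D : ℕ) :
    ContinuousOn (phi₀ β) {ε | ∀ k, ε k ≤ D} := by
  obtain ⟨u, K, ρ, l, hρ, hρ1, -, hu, -⟩ := exists_trace_sequence hβ hb
  obtain ⟨B, hB, hle⟩ := exists_liftTerm_bound hβ.one_lt hρ hρ1 hu 0 D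
  refine continuousOn_tsum (u := B) (fun k => ?_) hB fun k ε hε => ?_
  · have h1 : Continuous fun j : ℕ => j • Tpow β (-k) (homoclinic β (xi₀ β)) :=
      continuous_of_discreteTopology
    exact (h1.comp (continuous_apply k : Continuous fun ε : ℤ → ℕ => ε k)).continuousOn
  · rw [← proj_liftTerm hβ hb u 0]
    exact (norm_proj_le _).trans (hle ε hε k)

/-- The image of the bounded sequences with a given tail is a null set. -/
theorem volume_phi₀_image_tail (hβ : IsPisotUnit β)
    (hb : (charPol β).map (Int.castRingHom ℂ) = ∏ i, (X - C (b i))) (D : ℕ) (n : ℤ) (d : ℕ → ℕ) :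
    volume (phi₀ β '' {ε | (∀ k, ε k ≤ D) ∧ ∀ j : ℕ, ε (n + j) = d j}) = 0 := by
  obtain ⟨u, K, ρ, l, hρ, hρ1, hl, hu, hlu⟩ := exists_trace_sequence hβ hb
  obtain ⟨B, hB, hle⟩ := exists_liftTerm_bound hβ.one_lt hρ hρ1 hu n D
  -- Lift terms left of `n` lie in the kernel of `l`, so `l` of the lift depends on the prescribed
  -- tail alone; this sum is its value.
  refine measure_mono_null ?_ (volume_proj_hyperplane hl (∑' k : ℤ, if k < n then 0 else
    d (k - n).toNat * ∑ i : Fin (deg β), l i * (xi₀ β * β ^ (-k - ((i : ℕ) : ℤ)))))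
  rintro _ ⟨ε, ⟨hεD, hεd⟩, rfl⟩
  have hs : Summable (liftTerm β u n ε) := Summable.of_norm_bounded hB (hle ε hεD)
  refine ⟨∑' k, liftTerm β u n ε k, ?_, ?_⟩
  · let L : (Fin (deg β) → ℝ) →L[ℝ] ℝ := ∑ i, l i • ContinuousLinearMap.proj i
    have hL : ∀ x, L x = ∑ i, l i * x i := fun x => by simp [L]
    simp only [Set.mem_ofPred_eq]
    rw [← hL, L.map_tsum hs]
    refine tsum_congr fun k => ?_
    rw [hL]
    by_cases hk : k < n
    · simp only [liftTerm, hk, if_true]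
      rw [← mul_zero (ε k : ℝ), ← hlu (-k), Finset.mul_sum]
      exact Finset.sum_congr rfl fun i _ => by ring
    · have h1 := hεd (k - n).toNat
      rw [show n + ((k - n).toNat : ℤ) = k by omega] at h1
      simp only [liftTerm, hk, if_false, sub_zero, h1, Finset.mul_sum]
      exact Finset.sum_congr rfl fun i _ => by ring
  · rw [hs.map_tsum (proj (deg β)) continuous_proj]
    exact tsum_congr fun k => proj_liftTerm hβ hb u n ε k

/-- Expanding $s\ge0$ in base β shows that the image contains the projection of
$s\,\xi_0(1,\beta^{-1},\dots)$. Kronecker applies because $1,\beta^{-1},\dots,\beta^{-m+1}$ are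
linearly independent over ℤ. -/
theorem dense_phi₀_image (hβ : IsPisotUnit β)
    (hb : (charPol β).map (Int.castRingHom ℂ) = ∏ i, (X - C (b i))) :
    Dense (phi₀ β '' compactum β) := by
  have hβ0 : 0 < β := zero_lt_one.trans hβ.one_lt
  refine (dense_proj_ray (v := fun i : Fin (deg β) => xi₀ β * β⁻¹ ^ (i : ℕ)) ?_).mono ?_
  · intro n hn h
    have hξ : xi₀ β ≠ 0 := inv_ne_zero (aeval_derivative_ne_zero hβ.isIntegral hb)
    -- An integer relation, cleared of $\xi_0$ and multiplied by $\beta^{m-1}$, is a polynomial of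
    -- degree below $m$ vanishing at β.
    let p : ℤ[X] := ∑ i : Fin (deg β), C (n i) * X ^ (deg β - 1 - (i : ℕ))
    have hp : aeval β p = 0 := by
      have h1 : aeval β p = β ^ (deg β - 1) * (xi₀ β)⁻¹ *
          ∑ i, n i * (xi₀ β * β⁻¹ ^ (i : ℕ)) := by
        simp only [p, map_sum, map_mul, map_pow, aeval_X, eq_intCast, map_intCast, Finset.mul_sum]
        refine Finset.sum_congr rfl fun i _ => ?_
        have h2 : deg β - 1 = (deg β - 1 - i) + i := by have := i.2; omega
        conv_rhs => rw [h2, pow_add]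
        rw [inv_pow]
        field_simp
      rw [h1, h, mul_zero]
    have hdeg : p.degree < (charPol β).degree := by
      rw [degree_eq_natDegree (minpoly.monic hβ.isIntegral).ne_zero]
      refine (degree_sum_le _ _).trans_lt ((Finset.sup_lt_iff (WithBot.bot_lt_coe _)).2 fun i _ => ?_)
      refine (degree_C_mul_X_pow_le _ _).trans_lt ?_
      have := i.2
      exact_mod_cast (show deg β - 1 - (i : ℕ) < deg β by omega)
    have hp0 : p = 0 := by
      obtain ⟨q, hq⟩ := minpoly.isIntegrallyClosed_dvd hβ.isIntegral hp
      by_contra hne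
      refine not_le.2 hdeg ?_
      exact degree_le_of_dvd ⟨q, hq⟩ hne
    refine hn (funext fun i => ?_)
    have := congrArg (fun p => p.coeff (deg β - 1 - i)) hp0
    simp only [p, finsetSum_coeff, coeff_C_mul, coeff_X_pow, coeff_zero] at this
    rw [Finset.sum_eq_single i] at this
    · simpa using this
    · intro j _ hj
      have h1 : ¬ deg β - 1 - (i : ℕ) = deg β - 1 - (j : ℕ) := fun h =>
        hj (Fin.ext (by have := i.2; have := j.2; omega))
      rw [if_neg h1, mul_zero]
    · simp
  · rintro _ ⟨s, hs, rfl⟩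
    obtain ⟨ε, hε, hsum⟩ := exists_mem_compactum_hasSum hβ.one_lt hs
    refine ⟨ε, hε, ?_⟩
    have h1 : HasSum (fun k : ℤ => fun i : Fin (deg β) =>
        (ε k : ℝ) * (xi₀ β * β ^ (-k - ((i : ℕ) : ℤ))))
        (s • fun i : Fin (deg β) => xi₀ β * β⁻¹ ^ (i : ℕ)) := by
      rw [Pi.hasSum]
      intro i
      convert! hsum.mul_right (xi₀ β * β⁻¹ ^ (i : ℕ)) using 2 with k
      rw [zpow_sub₀ hβ0.ne', zpow_natCast, inv_pow]
      ring
    have h2 := h1.map (proj (deg β)) continuous_proj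
    refine Eq.trans ?_ h2.tsum_eq
    exact tsum_congr fun k => codingTerm_eq hβ hb _ ε k

/-- The closure of the admissible sequences maps onto the torus, its image being compact and dense.
The sequences added by taking the closure end in $d$ and contribute a countable union of null sets.
-/
theorem ae_mem_phi₀_image (hβ : IsPisotUnit β)
    (hb : (charPol β).map (Int.castRingHom ℂ) = ∏ i, (X - C (b i))) :
    ∀ᵐ x ∂(volume : Measure (Torus (deg β))), x ∈ phi₀ β '' compactum β := by
  set D := quasiGreedyOne β 0
  have hYc : IsCompact {ε : ℤ → ℕ | ∀ k, ε k ≤ D} := by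
    have := isCompact_univ_pi (X := fun _ : ℤ => ℕ) (s := fun _ => Set.Iic D)
      fun _ => (Set.finite_Iic D).isCompact
    convert! this using 1
    ext; simp [Pi.le_def]
  have hsub : closure (compactum β) ⊆ {ε : ℤ → ℕ | ∀ k, ε k ≤ D} :=
    closure_minimal (fun ε hε k => digit_le_of_mem_compactum hε k) hYc.isClosed
  have hcomp : IsCompact (closure (compactum β)) := hYc.of_isClosed_subset isClosed_closure hsub
  have hsurj : phi₀ β '' closure (compactum β) = Set.univ := by
    have hc := (hcomp.image_of_continuousOn ((continuousOn_phi₀ hβ hb D).mono hsub)).isClosed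
    rw [← hc.closure_eq]
    exact ((dense_phi₀_image hβ hb).mono (Set.image_mono subset_closure)).closure_eq
  have hnull : volume (⋃ n : ℤ,
      phi₀ β '' {ε | (∀ k, ε k ≤ D) ∧ ∀ j : ℕ, ε (n + j) = quasiGreedyOne β j}) = 0 :=
    measure_iUnion_null fun n => volume_phi₀_image_tail hβ hb D n _
  refine measure_mono_null (fun x hx => ?_) hnull
  obtain ⟨ε, hε, rfl⟩ : x ∈ phi₀ β '' closure (compactum β) := hsurj ▸ Set.mem_univ x
  obtain ⟨n, hn⟩ := exists_tail_eq_of_mem_closure hε fun h => hx ⟨ε, h, rfl⟩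
  exact Set.mem_iUnion.2 ⟨n, ε, ⟨hsub hε, hn⟩, rfl⟩

theorem codingTerm_one_eq (hβ : IsPisotUnit β)
    (hb : (charPol β).map (Int.castRingHom ℂ) = ∏ i, (X - C (b i))) (ε : ℤ → ℕ) (k : ℤ) :
    toralEnd (aeval (companion β) (derivative (charPol β))) (codingTerm β (xi₀ β) ε k) =
      codingTerm β 1 ε k := by
  rw [toralEnd_codingTerm hβ hb, xi₀,
    mul_inv_cancel₀ (aeval_derivative_ne_zero hβ.isIntegral hb)]

theorem phi_eq_toralEnd_phi₀ (hβ : IsPisotUnit β)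
    (hb : (charPol β).map (Int.castRingHom ℂ) = ∏ i, (X - C (b i))) {ε : ℤ → ℕ}
    (hε : ε ∈ compactum β) :
    phi β ε = toralEnd (aeval (companion β) (derivative (charPol β))) (phi₀ β ε) := by
  rw [phi₀, coding, (summable_codingTerm hβ hb fun k => digit_le_of_mem_compactum hε k).map_tsum _
    (continuous_toralEnd _)]
  exact (tsum_congr fun k => codingTerm_one_eq hβ hb ε k).symm

end Coding

end PisotCoding

end

/-! ### The extension and its determinant. -/

theorem lemma3p3 (β : ℝ) (hβ : PisotCoding.IsPisotUnit β) (hfin : PisotCoding.IsFinitary β)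
    -- the conjugates of `β`
    (b : Fin (PisotCoding.deg β) → ℂ)
    (hb : (PisotCoding.charPol β).map (Int.castRingHom ℂ) = ∏ i, (X - C (b i))) :
    -- `φ₀` and `φ` are given by convergent series
    (∀ ε ∈ PisotCoding.compactum β,
      Summable (PisotCoding.codingTerm β (PisotCoding.xi₀ β) ε) ∧
        Summable (PisotCoding.codingTerm β 1 ε)) ∧
    -- `φ ∘ φ₀⁻¹` is well defined almost everywhere
    (∀ᵐ x ∂(volume : Measure (PisotCoding.Torus (PisotCoding.deg β))),
      ∃! y, PisotCoding.IsValue β x y) ∧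
    -- it has exactly one continuous extension `A`, an endomorphism with a unique matrix `N`
    ∃ A : PisotCoding.Torus (PisotCoding.deg β) → PisotCoding.Torus (PisotCoding.deg β),
      PisotCoding.IsContinuousExtension β A ∧
      (∀ A', PisotCoding.IsContinuousExtension β A' → A' = A) ∧
      ∃ N : Matrix (Fin (PisotCoding.deg β)) (Fin (PisotCoding.deg β)) ℤ,
        A = ⇑(PisotCoding.toralEnd N) ∧
        (∀ N', A = ⇑(PisotCoding.toralEnd N') → N' = N) ∧
        -- `A = p(T)` whenever `p(β) = ξ₀⁻¹ = g'(β)`; in particular for `p = g'`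
        (PisotCoding.xi₀ β)⁻¹ = aeval β (derivative (PisotCoding.charPol β)) ∧
        (∀ p : ℤ[X], aeval β p = (PisotCoding.xi₀ β)⁻¹ →
          A = ⇑(aeval (PisotCoding.T β) p) ∧ N = aeval (PisotCoding.companion β) p) ∧
        ((N.det : ℂ) = PisotCoding.discriminant b ∨
          (N.det : ℂ) = -PisotCoding.discriminant b) := by
  have hval : ∀ x y, PisotCoding.IsValue β x y → y = PisotCoding.toralEnd
      (aeval (PisotCoding.companion β) (derivative (PisotCoding.charPol β))) x := by
    rintro x y ⟨ε, hε, rfl, rfl⟩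
    exact PisotCoding.phi_eq_toralEnd_phi₀ hβ hb hε
  have hae : ∀ᵐ x ∂(volume : Measure (PisotCoding.Torus (PisotCoding.deg β))),
      PisotCoding.IsValue β x (PisotCoding.toralEnd
        (aeval (PisotCoding.companion β) (derivative (PisotCoding.charPol β))) x) := by
    filter_upwards [PisotCoding.ae_mem_phi₀_image hβ hb] with x hx
    obtain ⟨ε, hε, rfl⟩ := hx
    exact ⟨ε, hε, rfl, PisotCoding.phi_eq_toralEnd_phi₀ hβ hb hε⟩
  have hcont := PisotCoding.continuous_toralEnd
    (aeval (PisotCoding.companion β) (derivative (PisotCoding.charPol β)))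
  refine ⟨fun ε hε => ?_, ?_, _, ⟨hcont, hae⟩, fun A' hA' => ?_, _, rfl,
    fun N' hN' => (PisotCoding.toralEnd_injective hN').symm, inv_inv _, fun p hp => ?_, ?_⟩
  · have hs := PisotCoding.summable_codingTerm hβ hb
      fun k => PisotCoding.digit_le_of_mem_compactum hε k
    exact ⟨hs, (hs.map _ hcont).congr fun k => PisotCoding.codingTerm_one_eq hβ hb ε k⟩
  · filter_upwards [hae] with x hx
    exact ⟨_, hx, hval x⟩
  -- Haar measure charges every nonempty open set, so continuous maps that agree almost everywhere
  -- are equal.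
  · refine (hA'.1.ae_eq_iff_eq volume hcont).1 ?_
    filter_upwards [hA'.2] with x hx
    exact hval x _ hx
  · rw [PisotCoding.xi₀, inv_inv] at hp
    have h := PisotCoding.aeval_companion_congr hβ hb hp
    exact ⟨by rw [PisotCoding.T, PisotCoding.aeval_toralEnd, h], h.symm⟩
  · rw [PisotCoding.det_aeval_companion hβ hb]
    exact PisotCoding.prod_conj_derivative hb
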